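/- Let $d\ge 1$, let $\mathbb T^d=\mathbb R^d/\mathbb Z^d$ with normalized Lebesgue measure $m$, and let $L^2_0(\mathbb T^d)$ be the space of complex square-integrable functions with $m(f)=0$, with the $L^2$-norm $\|\cdot\|$. Let $A$ be a $d\times d$ integer matrix with $\det A=\pm1$ that is diagonalizable over $\mathbb C$, and suppose that the toral automorphism $F(x)=A^{t}x \bmod 1$ is ergodic with respect to $m$. Let $P_1,\dots,P_r$ be the distinct monic irreducible factors over $\mathbb Q$ of the characteristic polynomial of $A$, and let the minimal dimensionally averaged entropy of $F$ be $$\hat h(F)=\min_{1\le j\le r}\frac{h_j}{\deg P_j},\qquad h_j=\sum_{P_j(z)=0,\ |z|>1}\ln|z| ,$$ where the sum runs over the complex roots of $P_j$ ($h_j$ is the Kolmogorov–Sinai entropy of a toral automorphism with characteristic polynomial $P_j$). For $\varepsilon>0$ let $G_\varepsilon$ be the convolution with the Gaussian kernel $\sum_{k\in\mathbb Z^d}e^{-|\varepsilon k|^2}e^{2\pi i k\cdot x}$; it is an injective operator on $L^2_0(\mathbb T^d)$. Put $U_Ff=f\circ F$, $T_\varepsilon=G_\varepsilon U_F$, and $$C^\varepsilon_{f,h}(n)=m\big(f\,T_\varepsilon^n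 h\big),\qquad C_{f,h}(n)=m\big(f\,U_F^n h\big).$$ For every $\lambda$ with $0<\lambda<e^{2\hat h(F)}$ (in particular whenever $0<\lambda<\hat h(F)$) there is an integer $N\ge 1$, depending only on $F$ and $\lambda$, such that for all $n\ge N$ and all $\varepsilon>0$: 1. for all $f,h\in L^2_0(\mathbb T^d)$, $\ |C^\varepsilon_{f,h}(n)|\le \|f\|\,\|h\|\,e^{-\varepsilon^2\lambda^n}$; 2. for all $f,h\in G_\varepsilon(L^2_0(\mathbb T^d))$, $\ |C_{f,h}(n)|\le \|G_\varepsilon^{-1}f\|\,\|G_\varepsilon^{-1}h\|\,e^{-\varepsilon^2\lambda^n}$. If $\lambda\le 1$ one can take $N=1$. Consequently, for every $\varepsilon>0$, the correlations in 1 and in 2 decay super-exponentially: $r^n|C^\varepsilon_{f,h}(n)|\to0$, respectively $r^n|C_{f,h}(n)|\to0$, as $n\to\infty$, for every $r>0$. -/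

import Mathlib

open MeasureTheory Filter Topology

noncomputable section

namespace ToralNoise

/-- Normalized Lebesgue (Haar) measure on the torus `𝕋^d = (ℝ/ℤ)^d`. -/
def torusMeasure (d : ℕ) : Measure (UnitAddTorus (Fin d)) :=
  Measure.pi fun _ => AddCircle.haarAddCircle

/-- The toral endomorphism `F_A(x) = Aᵗ x mod 1`, so that `e_k ∘ F_A = e_{A k}`. -/
def toralMap {d : ℕ} (A : Matrix (Fin d) (Fin d) ℤ) (x : UnitAddTorus (Fin d)) :
    UnitAddTorus (Fin d) :=
  fun i => ∑ j, A j i • x j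

/-- `A` is diagonalizable (over `ℂ`). -/
def IsDiagonalizable {d : ℕ} (A : Matrix (Fin d) (Fin d) ℤ) : Prop :=
  ∃ (P : Matrix (Fin d) (Fin d) ℂ) (D : Fin d → ℂ), IsUnit P.det ∧
    A.map (Int.cast : ℤ → ℂ) * P = P * Matrix.diagonal D

/-- The entropy of a toral automorphism with characteristic polynomial `P`:
the sum of `log |z|` over the complex roots `z` of `P` (with multiplicity) with `|z| > 1`.
Here `Real.posLog ‖z‖` is `log ‖z‖` if `‖z‖ > 1` and `0` otherwise. -/
def polyEntropy (P : Polynomial ℚ) : ℝ :=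
  ((P.aroots ℂ).map fun z => Real.posLog ‖z‖).sum

/-- The minimal dimensionally averaged entropy `ĥ(F_A)`: the minimum of `h(P) / deg P` over the
(finitely many) distinct monic irreducible factors `P` over `ℚ` of the characteristic polynomial
of `A`. -/
def minAvgEntropy {d : ℕ} (A : Matrix (Fin d) (Fin d) ℤ) : ℝ :=
  sInf {x : ℝ | ∃ P : Polynomial ℚ, P.Monic ∧ Irreducible P ∧
    P ∣ A.charpoly.map (Int.castRingHom ℚ) ∧ x = polyEntropy P / (P.natDegree : ℝ)}

/-- `f` represents an element of `L²₀(𝕋^d)`: square integrable with zero mean. -/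
def IsL20 {d : ℕ} (f : UnitAddTorus (Fin d) → ℂ) : Prop :=
  MemLp f 2 (torusMeasure d) ∧ ∫ x, f x ∂(torusMeasure d) = 0

/-- The `L²` norm (used only for square integrable functions). -/
def l2norm {d : ℕ} (f : UnitAddTorus (Fin d) → ℂ) : ℝ :=
  (eLpNorm f 2 (torusMeasure d)).toReal

/-- The Gaussian noise kernel of width `ε > 0` on the torus, `∑_k exp (-|ε k|²) e_k`; it is the
periodization of `ε^{-d} g(x / ε)`, where `g` is the Gaussian density on `ℝ^d` whose Fourier
transform is `exp (-|ξ|²)`. -/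
def gaussKernel {d : ℕ} (ε : ℝ) (x : UnitAddTorus (Fin d)) : ℂ :=
  ∑' k : Fin d → ℤ,
    (Real.exp (-∑ i, (ε * (k i : ℝ)) ^ 2) : ℂ) * UnitAddTorus.mFourier k x

/-- The noise operator `G_ε`: convolution with the Gaussian kernel. -/
def noiseOp {d : ℕ} (ε : ℝ) (f : UnitAddTorus (Fin d) → ℂ) : UnitAddTorus (Fin d) → ℂ :=
  fun x => ∫ y, gaussKernel ε (x - y) * f y ∂(torusMeasure d)

/-- The Koopman operator `U_F f = f ∘ F`. -/
def koopman {d : ℕ} (F : UnitAddTorus (Fin d) → UnitAddTorus (Fin d))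
    (f : UnitAddTorus (Fin d) → ℂ) : UnitAddTorus (Fin d) → ℂ :=
  f ∘ F

/-- The noisy propagator `T_ε = G_ε U_F`. -/
def noisyPropagator {d : ℕ} (F : UnitAddTorus (Fin d) → UnitAddTorus (Fin d)) (ε : ℝ)
    (f : UnitAddTorus (Fin d) → ℂ) : UnitAddTorus (Fin d) → ℂ :=
  noiseOp ε (koopman F f)

/-- The noiseless correlation `C_{f,h}(n) = m(f · U_F^n h)`. -/
def correlation {d : ℕ} (F : UnitAddTorus (Fin d) → UnitAddTorus (Fin d))
    (f h : UnitAddTorus (Fin d) → ℂ) (n : ℕ) : ℂ :=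
  ∫ x, f x * ((koopman F)^[n] h) x ∂(torusMeasure d)

/-- The noisy correlation `C^ε_{f,h}(n) = m(f · T_ε^n h)`. -/
def noisyCorrelation {d : ℕ} (F : UnitAddTorus (Fin d) → UnitAddTorus (Fin d)) (ε : ℝ)
    (f h : UnitAddTorus (Fin d) → ℂ) (n : ℕ) : ℂ :=
  ∫ x, f x * ((noisyPropagator F ε)^[n] h) x ∂(torusMeasure d)

/-- `f` (as an element of `L²`) lies in the range `G_ε(L²₀)`, with `G_ε⁻¹ f = f₀`. -/
def IsNoisePreimage {d : ℕ} (ε : ℝ) (f₀ f : UnitAddTorus (Fin d) → ℂ) : Prop :=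
  IsL20 f₀ ∧ f =ᵐ[torusMeasure d] noiseOp ε f₀

end ToralNoise

end

namespace ToralNoise

open IntermediateField

/-! ### Lower bound for the size of integer orbits. -/

section Arithmetic

/-! On the Fourier side `U_F` moves the coefficient at `k` to `A k`, and `G_ε` multiplies the
coefficient at `k` by `exp (-ε² |k|²)`. Hence `T_ε^n` damps the mode `k` by `exp (-ε² ∑_{1 ≤ j ≤ n}
|A^j k|²)`. If `f = G_ε f₀` and `h = G_ε h₀`, symmetry of `G_ε` gives `m(f U_F^n h) = m(f₀ G_ε U_F^n
G_ε h₀)`, where the damping is `exp (-ε² (|k|² + |A^n k|²))`. By Cauchy–Schwarz and Parseval both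
bounds reduce to a statement without `ε`: these energies are at least `λ^n` for all nonzero integer
`k` and all large `n` (`pow_le_orbit_energy`).

The arithmetic core is `exp_minAvgEntropy_le`. Take a left eigenvector `u` of `A` for `θ` with
algebraic integer entries in `K = ℚ(θ)` and `α = u · k ≠ 0`. For every embedding `σ` of `K`, both
`|σ α|` and `|σ α| |σ θ|^n = |σ (u · A^n k)|` are at most `C max(|k|, |A^n k|)`, so `|σ α| max(1, |σ
θ|)^n` is too. The product over `σ` of the `|σ α|` is at least 1, being the absolute value of a
nonzero integer, and the product of the `max(1, |σ θ|)` is the exponential of the entropy of the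
minimal polynomial of `θ`. Taking the root of order `deg θ` produces the dimensional average.

Super-exponential decay also needs `ĥ(F) > 0` (`minAvgEntropy_pos`): zero entropy of a factor would,
by Kronecker's theorem, make its roots roots of unity, contradicting ergodicity. -/

theorem exp_posLog {x : ℝ} (hx : 0 ≤ x) : Real.exp (Real.posLog x) = max 1 x := by
  rcases le_total x 1 with h | h
  · rw [max_eq_left h, (Real.posLog_eq_zero_iff x).2 (by rwa [abs_of_nonneg hx]), Real.exp_zero]
  · rw [max_eq_right h, Real.posLog_eq_log (by rwa [abs_of_nonneg hx]), Real.exp_log (by linarith)]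

/-- Embeddings correspond to roots of the minimal polynomial of the generator; separability makes
the root multiset duplicate-free, so the two sums have the same terms. -/
theorem sum_algHom_powerBasis_gen {F K E : Type*} [Field F] [CharZero F] [Field K] [Algebra F K]
    [FiniteDimensional F K] [Field E] [Algebra F E] (pb : PowerBasis F K) (g : E → ℝ) :
    ∑ σ : K →ₐ[F] E, g (σ pb.gen) = (((minpoly F pb.gen).aroots E).map g).sum := by
  classical
  have hnd : ((minpoly F pb.gen).aroots E).Nodup :=
    Polynomial.nodup_roots ((minpoly.irreducible pb.isIntegral_gen).separable.map)
  rw [Fintype.sum_equiv pb.liftEquiv' _ (fun x : { x // x ∈ (minpoly F pb.gen).aroots E } => g x)]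
  · exact (Finset.sum_subtype (⟨_, hnd⟩ : Finset E) (fun x => Iff.rfl) g).symm
  · intro σ
    simp

/-- The product is the absolute value of the field norm, which is a nonzero rational integer. -/
theorem one_le_prod_norm_algHom {K : Type*} [Field K] [Algebra ℚ K] [FiniteDimensional ℚ K] {α : K}
    (hα : α ≠ 0) (hint : IsIntegral ℤ α) : 1 ≤ ∏ σ : K →ₐ[ℚ] ℂ, ‖σ α‖ := by
  rw [← norm_prod, ← Algebra.norm_eq_prod_embeddings ℚ ℂ α]
  obtain ⟨m, hm⟩ := IsIntegrallyClosed.isIntegral_iff.1 (Algebra.isIntegral_norm ℚ hint)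
  have hm0 : m ≠ 0 := by
    rintro rfl
    exact (Algebra.norm_ne_zero_iff (R := ℚ).2 hα) (by rw [← hm]; simp)
  rw [← hm]
  simpa using mod_cast Int.one_le_abs hm0

theorem polyEntropy_nonneg (P : Polynomial ℚ) : 0 ≤ polyEntropy P := by
  refine Multiset.sum_nonneg fun x hx => ?_
  obtain ⟨z, -, rfl⟩ := Multiset.mem_map.1 hx
  exact Real.posLog_nonneg

variable {d : ℕ}

theorem minAvgEntropy_le {A : Matrix (Fin d) (Fin d) ℤ} {P : Polynomial ℚ} (hP : P.Monic)
    (hirr : Irreducible P) (hdvd : P ∣ A.charpoly.map (Int.castRingHom ℚ)) :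
    minAvgEntropy A ≤ polyEntropy P / P.natDegree :=
  csInf_le ⟨0, by
    rintro x ⟨P, -, -, -, rfl⟩
    exact div_nonneg (polyEntropy_nonneg P) (Nat.cast_nonneg _)⟩ ⟨P, hP, hirr, hdvd, rfl⟩

theorem eigenvector_iterate {R : Type*} [CommRing R] (A : Matrix (Fin d) (Fin d) ℤ) {v : Fin d → R}
    {θ : R} (hv : Matrix.vecMul v (A.map (Int.cast : ℤ → R)) = θ • v) (k : Fin d → ℤ) (n : ℕ) :
    v ⬝ᵥ (fun i => (((A ^ n).mulVec k i : ℤ) : R)) = θ ^ n * v ⬝ᵥ (fun i => (k i : R)) := by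
  induction n with
  | zero => simp
  | succ n ih =>
    have h : (fun i => (((A ^ (n + 1)).mulVec k i : ℤ) : R)) =
        (A.map (Int.cast : ℤ → R)).mulVec (fun i => (((A ^ n).mulVec k i : ℤ) : R)) := by
      rw [pow_succ', ← Matrix.mulVec_mulVec]
      ext i
      simp [Matrix.mulVec, dotProduct]
    rw [h, Matrix.dotProduct_mulVec, hv, smul_dotProduct, ih, smul_eq_mul, pow_succ', mul_assoc]

/-- If `k` is not annihilated by some complex left eigenvector for `θ`, then it is not annihilated
by some left eigenvector with coefficients in a field of definition of `θ`. -/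
theorem exists_eigenvector_of_field {K : Type*} [Field K] [Algebra K ℂ]
    (A : Matrix (Fin d) (Fin d) ℤ) (g : K) {k : Fin d → ℤ} {w : Fin d → ℂ}
    (hw : Matrix.vecMul w (A.map (Int.cast : ℤ → ℂ)) = algebraMap K ℂ g • w)
    (hwk : w ⬝ᵥ (fun i => (k i : ℂ)) ≠ 0) :
    ∃ v : Fin d → K, Matrix.vecMul v (A.map (Int.cast : ℤ → K)) = g • v ∧
      v ⬝ᵥ (fun i => (k i : K)) ≠ 0 := by
  set B : Matrix (Fin d) (Fin d) K := A.map (Int.cast : ℤ → K) - Matrix.scalar (Fin d) g with hB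
  -- Solvability of `B y = k` is the obstruction: a solution over `K` maps to one over `ℂ`, and then
  -- `w`, which kills the range of `A - θ`, would kill `k`. Without a solution, a `K`-linear
  -- functional separates `k` from the range of `B`; its coefficient vector is the eigenvector
  -- sought.
  have hk : (fun i => (k i : K)) ∉ LinearMap.range B.mulVecLin := by
    rintro ⟨y, hy⟩
    apply hwk
    have hy' : (fun i => (k i : ℂ)) =
        (A.map (Int.cast : ℤ → ℂ) - Matrix.scalar (Fin d) (algebraMap K ℂ g)).mulVec
          (fun i => algebraMap K ℂ (y i)) := by
      ext i
      have := congrArg (algebraMap K ℂ) (congrFun hy i)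
      rw [map_intCast, Matrix.mulVecLin_apply, RingHom.map_mulVec] at this
      rw [← this]
      congr 1
      ext i j
      by_cases hij : i = j <;> simp [hB, hij]
    rw [hy', Matrix.dotProduct_mulVec, Matrix.vecMul_sub, hw]
    have : Matrix.vecMul w (Matrix.scalar (Fin d) (algebraMap K ℂ g)) = algebraMap K ℂ g • w := by
      ext i; simp [Matrix.vecMul_diagonal, mul_comm]
    rw [this, sub_self, zero_dotProduct]
  obtain ⟨f, hf, hle⟩ := Submodule.exists_le_ker_of_notMem hk
  have hfv : ∀ x : Fin d → K, f x = (fun i => f (Pi.single i 1)) ⬝ᵥ x := by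
    intro x
    have hx : x = ∑ i, x i • (Pi.single i 1 : Fin d → K) := by
      ext j; simp [Finset.sum_apply, Pi.single_apply]
    refine (congrArg f hx).trans ?_
    simp [dotProduct, mul_comm]
  refine ⟨fun i => f (Pi.single i 1), ?_, by rwa [← hfv]⟩
  have h0 : Matrix.vecMul (fun i => f (Pi.single i 1)) B = 0 := by
    refine dotProduct_eq_zero_iff.1 fun x => ?_
    rw [← Matrix.dotProduct_mulVec, ← hfv]
    exact hle ⟨x, rfl⟩
  rw [hB, Matrix.vecMul_sub, sub_eq_zero] at h0
  rw [h0]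
  ext i; simp [Matrix.vecMul_diagonal, mul_comm]

theorem norm_map_dotProduct_le {K : Type*} [Field K] (σ : K →+* ℂ) (u : Fin d → K)
    (k : Fin d → ℤ) : ‖σ (u ⬝ᵥ fun i => (k i : K))‖ ≤ (∑ i, ‖σ (u i)‖) * ‖k‖ := by
  rw [dotProduct, map_sum, Finset.sum_mul]
  refine (norm_sum_le _ _).trans (Finset.sum_le_sum fun i _ => ?_)
  rw [map_mul, norm_mul, map_intCast, Complex.norm_intCast, ← Int.norm_eq_abs]
  exact mul_le_mul_of_nonneg_left (norm_le_pi_norm k i) (norm_nonneg _)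

theorem isIntegral_eigenvalue {A : Matrix (Fin d) (Fin d) ℤ} {θ : ℂ}
    (hθ : Polynomial.aeval θ A.charpoly = 0) : IsIntegral ℤ θ :=
  ⟨A.charpoly, A.charpoly_monic, by simpa [Polynomial.aeval_def] using hθ⟩

theorem minpoly_dvd_charpoly {A : Matrix (Fin d) (Fin d) ℤ} {θ : ℂ}
    (hθ : Polynomial.aeval θ A.charpoly = 0) :
    minpoly ℚ θ ∣ A.charpoly.map (Int.castRingHom ℚ) := by
  refine minpoly.dvd ℚ θ ?_
  rw [show Int.castRingHom ℚ = algebraMap ℤ ℚ from rfl, Polynomial.aeval_map_algebraMap, hθ]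

theorem exp_sum_posLog_le_of_integral_eigenvector {K : Type*} [Field K] [Algebra ℚ K]
    [FiniteDimensional ℚ K] (A : Matrix (Fin d) (Fin d) ℤ) {g : K} {u : Fin d → K}
    (hu : Matrix.vecMul u (A.map (Int.cast : ℤ → K)) = g • u) (hint : ∀ i, IsIntegral ℤ (u i))
    {C : ℝ} (hC : ∀ σ : K →ₐ[ℚ] ℂ, ∑ i, ‖σ (u i)‖ ≤ C) (k : Fin d → ℤ)
    (hk : u ⬝ᵥ (fun i => (k i : K)) ≠ 0) (n : ℕ) :
    Real.exp (n * ∑ σ : K →ₐ[ℚ] ℂ, Real.posLog ‖σ g‖) ≤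
      (C * max ‖k‖ ‖(A ^ n).mulVec k‖) ^ Module.finrank ℚ K := by
  obtain ⟨α, hα⟩ : ∃ α, u ⬝ᵥ (fun i => (k i : K)) = α := ⟨_, rfl⟩
  have hαint : IsIntegral ℤ α := by
    rw [← hα]
    exact IsIntegral.sum _ fun i _ => (hint i).mul
      (map_isIntegral_int (Int.castRingHom K) (Algebra.IsIntegral.isIntegral (k i)))
  rw [hα] at hk
  have hbound : ∀ σ : K →ₐ[ℚ] ℂ, ‖σ α‖ * Real.exp (n * Real.posLog ‖σ g‖) ≤
      C * max ‖k‖ ‖(A ^ n).mulVec k‖ := by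
    intro σ
    have hC0 : 0 ≤ C := le_trans (by positivity) (hC σ)
    have h1 : ‖σ α‖ ≤ C * ‖k‖ := by
      rw [← hα]
      exact (norm_map_dotProduct_le (σ : K →+* ℂ) u k).trans
        (mul_le_mul_of_nonneg_right (hC σ) (norm_nonneg _))
    have h2 : ‖σ α‖ * ‖σ g‖ ^ n ≤ C * ‖(A ^ n).mulVec k‖ := by
      have := (norm_map_dotProduct_le (σ : K →+* ℂ) u ((A ^ n).mulVec k)).trans
        (mul_le_mul_of_nonneg_right (hC σ) (norm_nonneg _))
      rwa [eigenvector_iterate A hu, hα, map_mul, map_pow, norm_mul, norm_pow, mul_comm] at this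
    -- The factor is now `max 1 ‖σ g‖ ^ n`: time `0` controls contracting embeddings, time `n` the
    -- expanding ones.
    rw [Real.exp_nat_mul, exp_posLog (norm_nonneg _)]
    rcases le_total ‖σ g‖ 1 with h | h
    · rw [max_eq_left h, one_pow, mul_one]
      exact h1.trans (by gcongr; exact le_max_left _ _)
    · rw [max_eq_right h]
      exact h2.trans (by gcongr; exact le_max_right _ _)
  calc Real.exp (n * ∑ σ : K →ₐ[ℚ] ℂ, Real.posLog ‖σ g‖)
      ≤ (∏ σ : K →ₐ[ℚ] ℂ, ‖σ α‖) * Real.exp (n * ∑ σ : K →ₐ[ℚ] ℂ, Real.posLog ‖σ g‖) :=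
        le_mul_of_one_le_left (Real.exp_pos _).le (one_le_prod_norm_algHom hk hαint)
    _ = ∏ σ : K →ₐ[ℚ] ℂ, ‖σ α‖ * Real.exp (n * Real.posLog ‖σ g‖) := by
        rw [Finset.prod_mul_distrib, Finset.mul_sum, Real.exp_sum]
    _ ≤ ∏ _σ : K →ₐ[ℚ] ℂ, (C * max ‖k‖ ‖(A ^ n).mulVec k‖) :=
        Finset.prod_le_prod (fun _ _ => by positivity) fun σ _ => hbound σ
    _ = _ := by rw [Finset.prod_const, Finset.card_univ, AlgHom.card]

/-- The point is that `C` does not depend on `k`. The eigenspace over `K` has a finite generating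
set, one integer `y` clears the denominators of all generators, and some generator does not
annihilate `k`, since otherwise the whole eigenspace would. -/
theorem exp_sum_posLog_le_of_eigenvalue {K : Type*} [Field K] [Algebra ℚ K] [FiniteDimensional ℚ K]
    [Algebra K ℂ] (A : Matrix (Fin d) (Fin d) ℤ) (g : K) :
    ∃ C : ℝ, 0 < C ∧ ∀ k : Fin d → ℤ,
      (∃ w : Fin d → ℂ, Matrix.vecMul w (A.map (Int.cast : ℤ → ℂ)) = algebraMap K ℂ g • w ∧
        w ⬝ᵥ (fun i => (k i : ℂ)) ≠ 0) →
      ∀ n : ℕ, Real.exp (n * ∑ σ : K →ₐ[ℚ] ℂ, Real.posLog ‖σ g‖) ≤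
        (C * max ‖k‖ ‖(A ^ n).mulVec k‖) ^ Module.finrank ℚ K := by
  classical
  obtain ⟨W, hmemW⟩ : ∃ W : Submodule K (Fin d → K),
      ∀ v, v ∈ W ↔ Matrix.vecMul v (A.map (Int.cast : ℤ → K)) = g • v :=
    ⟨LinearMap.ker ((A.map (Int.cast : ℤ → K)).vecMulLinear - g • LinearMap.id),
      fun v => by simp [sub_eq_zero]⟩
  obtain ⟨S, hS⟩ := (IsNoetherian.noetherian W : W.FG)
  have : CharZero K := algebraRat.charZero K
  have : Algebra.IsAlgebraic ℤ K :=
    (IsFractionRing.comap_isAlgebraic_iff (A := ℤ) (K := ℚ) (C := K)).2 inferInstance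
  obtain ⟨y, hy, hyint⟩ := Algebra.IsAlgebraic.exists_integral_multiples ℤ
    (A := K) (S.biUnion fun v => Finset.univ.image v)
  have hyint' : ∀ v ∈ S, ∀ i, IsIntegral ℤ ((y • v) i) := fun v hv i =>
    hyint _ (Finset.mem_biUnion.2 ⟨v, hv, Finset.mem_image_of_mem _ (Finset.mem_univ i)⟩)
  obtain ⟨b, hb⟩ : ∃ b : (Fin d → K) → ℝ,
      ∀ v, 0 ≤ b v ∧ ∀ σ : K →ₐ[ℚ] ℂ, ∑ i, ‖σ ((y • v) i)‖ ≤ b v :=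
    ⟨fun v => ∑ σ : K →ₐ[ℚ] ℂ, ∑ i, ‖σ ((y • v) i)‖, fun v => ⟨by positivity, fun σ =>
      Finset.single_le_sum (f := fun σ : K →ₐ[ℚ] ℂ => ∑ i, ‖σ ((y • v) i)‖)
        (fun _ _ => by positivity) (Finset.mem_univ σ)⟩⟩
  have hb0 : 0 ≤ ∑ v ∈ S, b v := Finset.sum_nonneg fun v _ => (hb v).1
  refine ⟨1 + ∑ v ∈ S, b v, by linarith, fun k ⟨w, hw, hwk⟩ n => ?_⟩
  obtain ⟨v, hvS, hvk⟩ : ∃ v ∈ S, v ⬝ᵥ (fun i => (k i : K)) ≠ 0 := by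
    by_contra! hcon
    obtain ⟨u, hu, huk⟩ := exists_eigenvector_of_field A g hw hwk
    refine huk ?_
    have hmem : u ∈ Submodule.span K (S : Set (Fin d → K)) := hS ▸ (hmemW u).2 hu
    clear hu huk
    induction hmem using Submodule.span_induction with
    | mem x hx => exact hcon x hx
    | zero => simp
    | add x z _ _ hx hz => rw [add_dotProduct, hx, hz, add_zero]
    | smul a x _ hx => rw [smul_dotProduct, hx, smul_zero]
  refine exp_sum_posLog_le_of_integral_eigenvector A (u := y • v) ?_ (hyint' v hvS)
    (fun σ => ((hb v).2 σ).trans ?_) k ?_ n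
  · rw [Matrix.smul_vecMul, (hmemW v).1 (hS ▸ Submodule.subset_span hvS), smul_comm]
  · have := Finset.single_le_sum (fun v _ => (hb v).1) hvS
    linarith
  · rw [smul_dotProduct]
    exact smul_ne_zero hy hvk

theorem exp_entropy_le_of_powerBasis {K : Type*} [Field K] [Algebra ℚ K] [FiniteDimensional ℚ K]
    [Algebra K ℂ] (A : Matrix (Fin d) (Fin d) ℤ) (pb : PowerBasis ℚ K) :
    ∃ C : ℝ, 0 < C ∧ ∀ k : Fin d → ℤ,
      (∃ w : Fin d → ℂ, Matrix.vecMul w (A.map (Int.cast : ℤ → ℂ)) = algebraMap K ℂ pb.gen • w ∧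
        w ⬝ᵥ (fun i => (k i : ℂ)) ≠ 0) →
      ∀ n : ℕ, Real.exp (n * polyEntropy (minpoly ℚ pb.gen)) ≤
        (C * max ‖k‖ ‖(A ^ n).mulVec k‖) ^ pb.dim := by
  rw [polyEntropy, ← sum_algHom_powerBasis_gen pb fun z => Real.posLog ‖z‖, ← pb.finrank]
  exact exp_sum_posLog_le_of_eigenvalue A pb.gen

theorem exp_minAvgEntropy_le_of_eigenvalue (A : Matrix (Fin d) (Fin d) ℤ) {θ : ℂ}
    (hθ : Polynomial.aeval θ A.charpoly = 0) :
    ∃ C : ℝ, 0 < C ∧ ∀ k : Fin d → ℤ,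
      (∃ w : Fin d → ℂ, Matrix.vecMul w (A.map (Int.cast : ℤ → ℂ)) = θ • w ∧
        w ⬝ᵥ (fun i => (k i : ℂ)) ≠ 0) →
      ∀ n : ℕ, Real.exp (n * minAvgEntropy A) ≤ C * max ‖k‖ ‖(A ^ n).mulVec k‖ := by
  have hθQ : IsIntegral ℚ θ := (isIntegral_eigenvalue hθ).tower_top
  have : FiniteDimensional ℚ ℚ⟮θ⟯ := adjoin.finiteDimensional hθQ
  obtain ⟨C, hC, h⟩ := exp_entropy_le_of_powerBasis A (adjoin.powerBasis hθQ)
  refine ⟨C, hC, fun k hk n => ?_⟩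
  have hk' := h k (by rwa [adjoin.powerBasis_gen, AdjoinSimple.algebraMap_gen]) n
  rw [adjoin.powerBasis_dim, adjoin.powerBasis_gen, minpoly_gen] at hk'
  have hD : 0 < (minpoly ℚ θ).natDegree := minpoly.natDegree_pos hθQ
  refine le_of_pow_le_pow_left₀ hD.ne' (by positivity) (le_trans ?_ hk')
  -- It remains to compare exponents: with `D` the degree of `minpoly ℚ θ`, `D` times the minimal
  -- average entropy is at most the entropy of that polynomial.
  rw [← Real.exp_nat_mul]
  have := minAvgEntropy_le (minpoly.monic hθQ) (minpoly.irreducible hθQ) (minpoly_dvd_charpoly hθ)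
  rw [le_div_iff₀ (by exact_mod_cast hD)] at this
  refine Real.exp_le_exp.2 ?_
  nlinarith [Nat.cast_nonneg (α := ℝ) n]

theorem aeval_charpoly_of_eigenvector {A : Matrix (Fin d) (Fin d) ℤ} {w : Fin d → ℂ} {θ : ℂ}
    (hw0 : w ≠ 0) (hw : Matrix.vecMul w (A.map (Int.cast : ℤ → ℂ)) = θ • w) :
    Polynomial.aeval θ A.charpoly = 0 := by
  have hdet : (Matrix.scalar (Fin d) θ - A.map (Int.cast : ℤ → ℂ)).det = 0 := by
    refine Matrix.exists_vecMul_eq_zero_iff.1 ⟨w, hw0, ?_⟩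
    rw [Matrix.vecMul_sub, hw, sub_eq_zero]
    ext i; simp [Matrix.vecMul_diagonal, mul_comm]
  rw [← Matrix.eval_charpoly] at hdet
  rw [Polynomial.aeval_def, ← Polynomial.eval_map, ← Matrix.charpoly_map]
  exact hdet

/-- Diophantine estimate: an orbit of nonzero integer vectors cannot be short both at time `0` and
at time `n`. -/
theorem exp_minAvgEntropy_le {A : Matrix (Fin d) (Fin d) ℤ} (hdiag : IsDiagonalizable A) :
    ∃ C : ℝ, 0 < C ∧ ∀ k : Fin d → ℤ, k ≠ 0 → ∀ n : ℕ,
      Real.exp (n * minAvgEntropy A) ≤ C * max ‖k‖ ‖(A ^ n).mulVec k‖ := by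
  obtain ⟨P, D, hP, hPD⟩ := hdiag
  -- The rows of `P⁻¹` form a basis of left eigenvectors, so no nonzero `k` is annihilated by all of
  -- them. This is where diagonalizability enters.
  have hrow : ∀ i, Matrix.vecMul (P⁻¹ i) (A.map (Int.cast : ℤ → ℂ)) = D i • P⁻¹ i := by
    intro i
    have h : P⁻¹ * A.map (Int.cast : ℤ → ℂ) = Matrix.diagonal D * P⁻¹ := by
      rw [← Matrix.mul_one (A.map (Int.cast : ℤ → ℂ)), ← Matrix.mul_nonsing_inv P hP,
        ← Matrix.mul_assoc (A.map _), hPD, Matrix.mul_assoc P, ← Matrix.mul_assoc P⁻¹,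
        Matrix.nonsing_inv_mul P hP, Matrix.one_mul]
    ext j
    have := congrFun (congrFun h i) j
    rw [Matrix.diagonal_mul] at this
    exact this
  have hne : ∀ i, P⁻¹ i ≠ 0 := by
    intro i hi
    have := congrFun (congrFun (Matrix.nonsing_inv_mul P hP) i) i
    rw [Matrix.mul_apply', hi, zero_dotProduct, Matrix.one_apply_eq] at this
    exact zero_ne_one this
  choose C hC h using fun i => exp_minAvgEntropy_le_of_eigenvalue A
    (aeval_charpoly_of_eigenvector (hne i) (hrow i))
  refine ⟨1 + ∑ i, C i, by have := Finset.sum_nonneg fun i (_ : i ∈ Finset.univ) => (hC i).le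
                           linarith, fun k hk n => ?_⟩
  obtain ⟨i, hi⟩ : ∃ i, P⁻¹ i ⬝ᵥ (fun i => (k i : ℂ)) ≠ 0 := by
    by_contra! hcon
    refine hk ?_
    have h0 : P⁻¹.mulVec (fun i => (k i : ℂ)) = 0 := funext hcon
    have h1 := congrArg P.mulVec h0
    rw [Matrix.mulVec_mulVec, Matrix.mul_nonsing_inv P hP, Matrix.one_mulVec,
      Matrix.mulVec_zero] at h1
    ext j
    simpa using congrFun h1 j
  refine (h i k ⟨_, hrow i, hi⟩ n).trans ?_
  gcongr
  have := Finset.single_le_sum (fun i _ => (hC i).le) (Finset.mem_univ i)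
  linarith

end Arithmetic

/-! ### Fourier coefficients on the torus and the noise operator. -/

section Fourier

open UnitAddTorus
open scoped ComplexConjugate

variable {d : ℕ}

instance : IsProbabilityMeasure (torusMeasure d) := by
  unfold torusMeasure; infer_instance

/-- The Fourier coefficients of a function on the torus. -/
noncomputable def torusCoeff (f : UnitAddTorus (Fin d) → ℂ) (k : Fin d → ℤ) : ℂ :=
  ∫ x, mFourier (-k) x * f x ∂(torusMeasure d)

theorem torusCoeff_congr {f g : UnitAddTorus (Fin d) → ℂ} (h : f =ᵐ[torusMeasure d] g)
    (k : Fin d → ℤ) : torusCoeff f k = torusCoeff g k :=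
  integral_congr_ae (h.mono fun x hx => by simp only [hx])

theorem torusCoeff_zero (f : UnitAddTorus (Fin d) → ℂ) :
    torusCoeff f 0 = ∫ x, f x ∂(torusMeasure d) := by
  simp [torusCoeff, mFourier_zero]

theorem hasSum_conj_torusCoeff_mul {f g : UnitAddTorus (Fin d) → ℂ}
    (hf : MemLp f 2 (torusMeasure d)) (hg : MemLp g 2 (torusMeasure d)) :
    HasSum (fun k => conj (torusCoeff f k) * torusCoeff g k)
      (∫ x, conj (f x) * g x ∂(torusMeasure d)) := by
  have h : HasSum (fun k => conj (torusCoeff (hf.toLp f) k) * torusCoeff (hg.toLp g) k)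
      (∫ x, conj (hf.toLp f x) * hg.toLp g x ∂(torusMeasure d)) :=
    hasSum_prod_mFourierCoeff (hf.toLp f) (hg.toLp g)
  simp only [torusCoeff_congr hf.coeFn_toLp, torusCoeff_congr hg.coeFn_toLp] at h
  convert h using 1
  refine integral_congr_ae ?_
  filter_upwards [hf.coeFn_toLp, hg.coeFn_toLp] with x h1 h2
  rw [h1, h2]

theorem norm_integral_mul_le {f g : UnitAddTorus (Fin d) → ℂ}
    (hf : MemLp f 2 (torusMeasure d)) (hg : MemLp g 2 (torusMeasure d)) :
    ‖∫ x, f x * g x ∂(torusMeasure d)‖ ≤ l2norm f * l2norm g := by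
  have hf' : MemLp (fun x => conj (f x)) 2 (torusMeasure d) := hf.star
  have h := norm_inner_le_norm (𝕜 := ℂ) (hf'.toLp _) (hg.toLp g)
  rw [L2.inner_def, Lp.norm_toLp, Lp.norm_toLp] at h
  have e : eLpNorm (fun x => conj (f x)) 2 (torusMeasure d) = eLpNorm f 2 (torusMeasure d) :=
    eLpNorm_congr_norm_ae (.of_forall fun x => by simp)
  rw [e] at h
  refine le_trans (le_of_eq ?_) h
  congr 1
  refine integral_congr_ae ?_
  filter_upwards [hf'.coeFn_toLp, hg.coeFn_toLp] with x h1 h2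
  rw [h1, h2]
  simp [mul_comm]

theorem hasSum_sq_norm_torusCoeff {f : UnitAddTorus (Fin d) → ℂ}
    (hf : MemLp f 2 (torusMeasure d)) :
    HasSum (fun k => ‖torusCoeff f k‖ ^ 2) (l2norm f ^ 2) := by
  have h : HasSum (fun k => ‖torusCoeff (hf.toLp f) k‖ ^ 2)
      (∫ x, ‖hf.toLp f x‖ ^ 2 ∂(torusMeasure d)) :=
    hasSum_sq_mFourierCoeff (hf.toLp f)
  simp only [torusCoeff_congr hf.coeFn_toLp] at h
  convert h using 1
  rw [l2norm, ← Lp.norm_toLp f hf]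
  have := L2.inner_def (𝕜 := ℂ) (hf.toLp f) (hf.toLp f)
  rw [inner_self_eq_norm_sq_to_K] at this
  simp only [inner_self_eq_norm_sq_to_K] at this
  exact_mod_cast this

/-- An operator acting on Fourier coefficients as a permutation followed by multiplication by
factors of modulus at most `c` has norm at most `c`. -/
theorem l2norm_le_of_torusCoeff {h w : UnitAddTorus (Fin d) → ℂ}
    (hh : MemLp h 2 (torusMeasure d)) (hw : MemLp w 2 (torusMeasure d)) {c : ℝ} (hc : 0 ≤ c)
    (B : (Fin d → ℤ) ≃ (Fin d → ℤ)) (hB : ∀ k, ‖torusCoeff w (B k)‖ ≤ c * ‖torusCoeff h k‖) :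
    l2norm w ≤ c * l2norm h := by
  have h1 := (B.hasSum_iff.2 (hasSum_sq_norm_torusCoeff hw))
  have h2 := (hasSum_sq_norm_torusCoeff hh).mul_left (c ^ 2)
  have h3 := hasSum_le (fun k => ?_) h1 h2
  · rw [← mul_pow] at h3
    exact le_of_pow_le_pow_left₀ two_ne_zero (mul_nonneg hc ENNReal.toReal_nonneg) h3
  · simp only [Function.comp_apply]
    rw [← mul_pow]
    exact pow_le_pow_left₀ (norm_nonneg _) (hB k) 2

/-- The correlation pairing is bilinear, so Parseval is applied to the conjugate of `f`, which turns
`k` into `-k`. -/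
theorem hasSum_torusCoeff_neg_mul {f g : UnitAddTorus (Fin d) → ℂ}
    (hf : MemLp f 2 (torusMeasure d)) (hg : MemLp g 2 (torusMeasure d)) :
    HasSum (fun k => torusCoeff f (-k) * torusCoeff g k) (∫ x, f x * g x ∂(torusMeasure d)) := by
  have hf' : MemLp (fun x => conj (f x)) 2 (torusMeasure d) := hf.star
  have h := hasSum_conj_torusCoeff_mul hf' hg
  simp only [Complex.conj_conj] at h
  convert h using 3 with k
  rw [torusCoeff, torusCoeff, ← integral_conj]
  simp [mFourier_neg]

theorem mFourier_toralMap (A : Matrix (Fin d) (Fin d) ℤ) (k : Fin d → ℤ)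
    (x : UnitAddTorus (Fin d)) : mFourier k (toralMap A x) = mFourier (A.mulVec k) x := by
  have h1 : ∀ (n : ℤ) (s : Finset (Fin d)) (y : Fin d → UnitAddCircle),
      fourier n (∑ j ∈ s, y j) = ∏ j ∈ s, (fourier n (y j) : ℂ) := by
    intro n s y
    induction s using Finset.induction_on with
    | empty => simp
    | insert a s ha ih =>
      rw [Finset.sum_insert ha, Finset.prod_insert ha, ← ih]
      simp only [fourier_apply, smul_add, AddCircle.toCircle_add, Circle.coe_mul]
  have h2 : ∀ (s : Finset (Fin d)) (n : Fin d → ℤ) (y : UnitAddCircle),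
      fourier (∑ j ∈ s, n j) y = ∏ j ∈ s, (fourier (n j) y : ℂ) := by
    intro s n y
    induction s using Finset.induction_on with
    | empty => simp
    | insert a s ha ih =>
      rw [Finset.sum_insert ha, Finset.prod_insert ha, ← ih, fourier_add]
  simp only [mFourier, ContinuousMap.coe_mk, toralMap, Matrix.mulVec, dotProduct, h1, h2]
  rw [Finset.prod_comm]
  refine Finset.prod_congr rfl fun j _ => Finset.prod_congr rfl fun i _ => ?_
  simp only [fourier_apply, smul_smul, mul_comm]

/-- The character of frequency `-A k` is the one of frequency `-k` composed with the map, so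
invariance of the measure removes the composition. -/
theorem torusCoeff_comp {A : Matrix (Fin d) (Fin d) ℤ}
    (hA : MeasurePreserving (toralMap A) (torusMeasure d) (torusMeasure d))
    {f : UnitAddTorus (Fin d) → ℂ} (hf : MemLp f 2 (torusMeasure d)) (k : Fin d → ℤ) :
    torusCoeff (f ∘ toralMap A) (A.mulVec k) = torusCoeff f k := by
  have hm : AEStronglyMeasurable (fun x => mFourier (-k) x * f x) (torusMeasure d) :=
    (mFourier (-k)).continuous.aestronglyMeasurable.mul hf.1
  have h := integral_map hA.measurable.aemeasurable (by rwa [hA.map_eq])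
  rw [hA.map_eq] at h
  simp only [torusCoeff, h, mFourier_toralMap, Matrix.mulVec_neg, Function.comp_apply]

theorem integral_mFourier (k : Fin d → ℤ) :
    ∫ x, mFourier k x ∂(torusMeasure d) = if k = 0 then 1 else 0 := by
  have h := orthonormal_iff_ite.1 (orthonormal_mFourier (d := Fin d)) 0 k
  simp only [ContinuousMap.inner_toLp, mFourier_zero] at h
  have h' : ∫ x, mFourier k x ∂(torusMeasure d) = if 0 = k then 1 else 0 := by
    rw [← h]
    refine integral_congr_ae (.of_forall fun x => ?_)
    simp
  simpa only [eq_comm] using h'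

theorem torusCoeff_mFourier (k l : Fin d → ℤ) :
    torusCoeff (mFourier l) k = if k = l then 1 else 0 := by
  simp only [torusCoeff, ← mFourier_add, integral_mFourier, neg_add_eq_zero]

/-- The square of the Euclidean norm of an integer vector. -/
def sqNorm (k : Fin d → ℤ) : ℝ := ∑ i, (k i : ℝ) ^ 2

theorem norm_sq_le_sqNorm (k : Fin d → ℤ) : ‖k‖ ^ 2 ≤ sqNorm k := by
  have h0 : 0 ≤ sqNorm k := Finset.sum_nonneg fun _ _ => sq_nonneg _
  refine (Real.le_sqrt (norm_nonneg _) h0).1 ((pi_norm_le_iff_of_nonneg (Real.sqrt_nonneg _)).2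
    fun i => Real.le_sqrt_of_sq_le ?_)
  rw [Int.norm_eq_abs, sq_abs]
  exact Finset.single_le_sum (f := fun i => (k i : ℝ) ^ 2) (fun _ _ => sq_nonneg _)
    (Finset.mem_univ i)

theorem gauss_weight (ε : ℝ) (k : Fin d → ℤ) :
    Real.exp (-∑ i, (ε * (k i : ℝ)) ^ 2) = Real.exp (-(ε ^ 2 * sqNorm k)) := by
  simp only [sqNorm, mul_pow, Finset.mul_sum]

theorem summable_gauss_int {t : ℝ} (ht : 0 < t) :
    Summable fun n : ℤ => Real.exp (-(t * (n : ℝ) ^ 2)) := by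
  -- The library kernel is `exp (-π n² t)`, hence the rescaling by `π`.
  have := HurwitzKernelBounds.summable_f_int 0 0 (t := t / Real.pi) (by positivity)
  refine this.congr fun n => ?_
  simp [HurwitzKernelBounds.f_int]
  field_simp

theorem summable_prod_pi {d : ℕ} {f : ℤ → ℝ} (hf : Summable f) (h0 : ∀ n, 0 ≤ f n) :
    Summable fun k : Fin d → ℤ => ∏ i, f (k i) := by
  induction d with
  | zero => exact (hasSum_fintype _).summable
  | succ d ih =>
    rw [← (Fin.consEquiv fun _ => ℤ).summable_iff]
    have := hf.mul_of_nonneg ih h0 (fun k => Finset.prod_nonneg fun i _ => h0 _)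
    refine this.congr fun p => ?_
    simp [Fin.prod_univ_succ]

theorem summable_gauss {ε : ℝ} (hε : 0 < ε) :
    Summable fun k : Fin d → ℤ => Real.exp (-(ε ^ 2 * sqNorm k)) := by
  refine (summable_prod_pi (summable_gauss_int (pow_pos hε 2)) fun _ => (Real.exp_pos _).le).congr
    fun k => ?_
  rw [← Real.exp_sum, Finset.sum_neg_distrib, ← Finset.mul_sum, sqNorm]

theorem mFourier_apply_norm (k : Fin d → ℤ) (x : UnitAddTorus (Fin d)) : ‖mFourier k x‖ = 1 := by
  simp only [mFourier, ContinuousMap.coe_mk, norm_prod, fourier_apply, Circle.norm_coe,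
    Finset.prod_const_one]

theorem mFourier_sub (k : Fin d → ℤ) (x y : UnitAddTorus (Fin d)) :
    mFourier k (x - y) = mFourier k x * mFourier (-k) y := by
  simp only [mFourier, ContinuousMap.coe_mk, ← Finset.prod_mul_distrib, Pi.sub_apply, Pi.neg_apply]
  refine Finset.prod_congr rfl fun i _ => ?_
  simp only [fourier_apply, sub_eq_add_neg, smul_add, AddCircle.toCircle_add, Circle.coe_mul,
    neg_smul, smul_neg]

theorem noiseOp_eq_tsum {ε : ℝ} (hε : 0 < ε) {f : UnitAddTorus (Fin d) → ℂ}
    (hf : MemLp f 2 (torusMeasure d)) (x : UnitAddTorus (Fin d)) :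
    noiseOp ε f x =
      ∑' k, (Real.exp (-(ε ^ 2 * sqNorm k)) : ℂ) * torusCoeff f k * mFourier k x := by
  have hf1 : Integrable f (torusMeasure d) := hf.integrable (by norm_num)
  set F : (Fin d → ℤ) → UnitAddTorus (Fin d) → ℂ := fun k y =>
    (Real.exp (-(ε ^ 2 * sqNorm k)) : ℂ) * mFourier k (x - y) * f y with hF
  have hnorm : ∀ k y, ‖F k y‖ = Real.exp (-(ε ^ 2 * sqNorm k)) * ‖f y‖ := by
    intro k y
    simp only [hF, norm_mul, mFourier_apply_norm, mul_one, Complex.norm_real, Real.norm_eq_abs,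
      Real.abs_exp]
  have hint : ∀ k, Integrable (F k) (torusMeasure d) := by
    intro k
    refine (hf1.norm.const_mul (Real.exp (-(ε ^ 2 * sqNorm k)))).mono' ?_
      (.of_forall fun y => (hnorm k y).le)
    exact Continuous.aestronglyMeasurable (by fun_prop) |>.mul hf.1
  have hsum : Summable fun k => ∫ y, ‖F k y‖ ∂(torusMeasure d) := by
    simp only [hnorm, integral_const_mul]
    exact (summable_gauss hε).mul_right _
  have h := hasSum_integral_of_summable_integral_norm hint hsum
  have e1 : noiseOp ε f x = ∫ y, ∑' k, F k y ∂(torusMeasure d) := by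
    refine integral_congr_ae (.of_forall fun y => ?_)
    simp only [gaussKernel, hF, tsum_mul_right, gauss_weight]
  rw [e1, ← h.tsum_eq]
  refine tsum_congr fun k => ?_
  simp only [hF, mFourier_sub, torusCoeff]
  rw [mul_right_comm, ← integral_const_mul]
  refine integral_congr_ae (.of_forall fun y => ?_)
  ring

theorem norm_torusCoeff_le {f : UnitAddTorus (Fin d) → ℂ} (k : Fin d → ℤ) :
    ‖torusCoeff f k‖ ≤ ∫ x, ‖f x‖ ∂(torusMeasure d) := by
  refine (norm_integral_le_integral_norm _).trans (le_of_eq ?_)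
  simp [mFourier_apply_norm]

/-- Absolute summability gives uniform convergence, hence continuity, and permits integrating term
by term against a character. -/
theorem exists_continuous_of_summable {a : (Fin d → ℤ) → ℂ} (ha : Summable fun k => ‖a k‖) :
    ∃ F : C(UnitAddTorus (Fin d), ℂ), (∀ x, F x = ∑' k, a k * mFourier k x) ∧
      ∀ k, torusCoeff F k = a k := by
  have hs : Summable fun k => a k • (mFourier k : C(UnitAddTorus (Fin d), ℂ)) := by
    refine Summable.of_norm ?_
    simpa only [norm_smul, mFourier_norm, mul_one] using ha
  have hx : ∀ x, (∑' k, a k • (mFourier k : C(UnitAddTorus (Fin d), ℂ))) x =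
      ∑' k, a k * mFourier k x := fun x => by
    exact (ContinuousMap.tsum_apply hs x).symm
  refine ⟨∑' k, a k • mFourier k, hx, fun k => ?_⟩
  have hnorm : ∀ l x, ‖mFourier (-k) x * (a l * mFourier l x)‖ = ‖a l‖ := by
    intro l x
    simp only [norm_mul, mFourier_apply_norm, mul_one, one_mul]
  have h := hasSum_integral_of_summable_integral_norm (μ := torusMeasure d)
    (F := fun l x => mFourier (-k) x * (a l * mFourier l x))
    (fun l => Integrable.of_bound (Continuous.aestronglyMeasurable (by fun_prop)) ‖a l‖
      (.of_forall fun x => (hnorm l x).le))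
    (by simpa only [hnorm, integral_const, probReal_univ, one_smul] using ha)
  have hl : ∀ l, ∫ x, mFourier (-k) x * (a l * mFourier l x) ∂(torusMeasure d) =
      if l = k then a l else 0 := by
    intro l
    simp only [mul_left_comm _ (a l), integral_const_mul, ← mFourier_add, integral_mFourier,
      neg_add_eq_zero, eq_comm (a := k), mul_ite, mul_one, mul_zero]
  simp only [hl, tsum_mul_left] at h
  rw [torusCoeff]
  simp only [hx]
  rw [h.unique (hasSum_ite_eq k (a k) |>.congr_fun fun l => by split_ifs with hlk <;> simp [hlk])]

theorem noiseOp_spec {ε : ℝ} (hε : 0 < ε) {f : UnitAddTorus (Fin d) → ℂ}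
    (hf : MemLp f 2 (torusMeasure d)) :
    MemLp (noiseOp ε f) 2 (torusMeasure d) ∧ ∀ k,
      torusCoeff (noiseOp ε f) k = Real.exp (-(ε ^ 2 * sqNorm k)) * torusCoeff f k := by
  have ha : Summable fun k : Fin d → ℤ =>
      ‖(Real.exp (-(ε ^ 2 * sqNorm k)) : ℂ) * torusCoeff f k‖ := by
    refine Summable.of_nonneg_of_le (fun _ => norm_nonneg _) (fun k => ?_)
      ((summable_gauss hε).mul_right (∫ x, ‖f x‖ ∂(torusMeasure d)))
    rw [norm_mul, Complex.norm_real, Real.norm_eq_abs, Real.abs_exp]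
    exact mul_le_mul_of_nonneg_left (norm_torusCoeff_le k) (Real.exp_pos _).le
  obtain ⟨F, hF, hFk⟩ := exists_continuous_of_summable ha
  have e : noiseOp ε f = F := funext fun x => by rw [noiseOp_eq_tsum hε hf, hF]
  rw [e]
  refine ⟨MemLp.of_bound F.continuous.aestronglyMeasurable ‖F‖
    (.of_forall F.norm_coe_le_norm), hFk⟩

/-- The Gaussian weight is even in `k`, so it can be attached to either factor of the pairing of
`-k` with `k`. -/
theorem integral_noiseOp_mul {ε : ℝ} (hε : 0 < ε) {f g : UnitAddTorus (Fin d) → ℂ}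
    (hf : MemLp f 2 (torusMeasure d)) (hg : MemLp g 2 (torusMeasure d)) :
    ∫ x, noiseOp ε f x * g x ∂(torusMeasure d) = ∫ x, f x * noiseOp ε g x ∂(torusMeasure d) := by
  have h1 := hasSum_torusCoeff_neg_mul (noiseOp_spec hε hf).1 hg
  have h2 := hasSum_torusCoeff_neg_mul hf (noiseOp_spec hε hg).1
  refine h1.unique ?_
  convert h2 using 2 with k
  rw [(noiseOp_spec hε hf).2, (noiseOp_spec hε hg).2]
  have : sqNorm (-k) = sqNorm k := by simp [sqNorm]
  rw [this]
  ring

end Fourier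

/-! ### Ergodicity forces positive entropy of every irreducible factor. -/

section Ergodicity

open UnitAddTorus IntermediateField

variable {d : ℕ} {A : Matrix (Fin d) (Fin d) ℤ}

/-- Summing the characters along a periodic orbit of frequencies gives a continuous invariant
function. Ergodicity makes it constant, yet its coefficient at the nonzero frequency `k` counts the
visits to `k`, including `j = 0`. -/
theorem pow_mulVec_ne_of_ergodic (herg : Ergodic (toralMap A) (torusMeasure d)) {k : Fin d → ℤ}
    (hk : k ≠ 0) {m : ℕ} (hm : 0 < m) : (A ^ m).mulVec k ≠ k := by
  intro hmk
  set f : UnitAddTorus (Fin d) → ℂ := fun x =>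
    ∑ j ∈ Finset.range m, mFourier ((A ^ j).mulVec k) x with hf
  have hcont : Continuous f := by fun_prop
  have hinv : f ∘ toralMap A = f := by
    ext x
    have h1 := Finset.sum_range_succ' (fun j => mFourier ((A ^ j).mulVec k) x) m
    rw [Finset.sum_range_succ, hmk, pow_zero, Matrix.one_mulVec] at h1
    simp only [hf, Function.comp_apply, mFourier_toralMap, Matrix.mulVec_mulVec, ← pow_succ']
    exact (add_right_cancel h1).symm
  obtain ⟨c, hc⟩ := herg.ae_eq_const_of_ae_eq_comp_ae hcont.aestronglyMeasurable
    (.of_forall fun x => congrFun hinv x)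
  have h0 : torusCoeff f k = 0 := by
    rw [torusCoeff_congr hc, torusCoeff]
    simp only [Function.const_apply, integral_mul_const, integral_mFourier, neg_eq_zero, hk,
      if_false, zero_mul]
  have h1 : torusCoeff f k =
      ∑ j ∈ Finset.range m, if k = (A ^ j).mulVec k then (1 : ℂ) else 0 := by
    simp only [torusCoeff, hf, Finset.mul_sum]
    rw [integral_finsetSum]
    · exact Finset.sum_congr rfl fun j _ => torusCoeff_mFourier _ _
    · intro j _
      exact (ContinuousMap.continuous
        (mFourier (-k) * mFourier ((A ^ j).mulVec k))).integrable_of_hasCompactSupport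
        (HasCompactSupport.of_compactSpace _)
  rw [h1, Finset.sum_boole, Nat.cast_eq_zero, Finset.card_eq_zero] at h0
  have : 0 ∈ (Finset.range m).filter fun j => k = (A ^ j).mulVec k := by simp [hm]
  simp [h0] at this

/-- If `θ ^ m = 1` then `A ^ m - 1` is singular over `ℂ`. Its determinant is an integer, so it also
has a nonzero integer kernel vector, that is, a periodic frequency. -/
theorem pow_ne_one_of_ergodic (herg : Ergodic (toralMap A) (torusMeasure d)) {θ : ℂ}
    (hθ : Polynomial.aeval θ A.charpoly = 0) {m : ℕ} (hm : 0 < m) : θ ^ m ≠ 1 := by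
  intro hθm
  rw [Polynomial.aeval_def, ← Polynomial.eval_map, ← Matrix.charpoly_map, Matrix.eval_charpoly]
    at hθ
  obtain ⟨w, hw0, hw⟩ := Matrix.exists_mulVec_eq_zero_iff.2 hθ
  set B : Matrix (Fin d) (Fin d) ℂ := A.map (algebraMap ℤ ℂ) with hB
  have hBw : B.mulVec w = θ • w := by
    rw [Matrix.sub_mulVec, sub_eq_zero] at hw
    rw [← hw]
    ext i; simp [Matrix.mulVec_diagonal]
  have hpow : ∀ n : ℕ, (B ^ n).mulVec w = θ ^ n • w := by
    intro n
    induction n with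
    | zero => simp
    | succ n ih => rw [pow_succ', ← Matrix.mulVec_mulVec, ih, Matrix.mulVec_smul, hBw, smul_smul,
        pow_succ]
  have hdet : (B ^ m - 1).det = 0 := by
    refine Matrix.exists_mulVec_eq_zero_iff.1 ⟨w, hw0, ?_⟩
    rw [Matrix.sub_mulVec, hpow, hθm, one_smul, Matrix.one_mulVec, sub_self]
  have hdet' : (A ^ m - 1).det = 0 := by
    have e : B ^ m - 1 = (algebraMap ℤ ℂ).mapMatrix (A ^ m - 1) := by
      rw [map_sub, map_pow, map_one]; rfl
    rw [e, ← RingHom.map_det] at hdet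
    exact (algebraMap ℤ ℂ).injective_int (hdet.trans (map_zero _).symm)
  obtain ⟨k, hk0, hk⟩ := Matrix.exists_mulVec_eq_zero_iff.2 hdet'
  rw [Matrix.sub_mulVec, Matrix.one_mulVec, sub_eq_zero] at hk
  exact pow_mulVec_ne_of_ergodic herg hk0 hm hk

/-- Kronecker's theorem in the field `ℚ(θ)`; every embedding sends the generator to a root of the
minimal polynomial. -/
theorem exists_pow_eq_one_of_conjugates_le_one {θ : ℂ} (hθ0 : θ ≠ 0) (hθ : IsIntegral ℤ θ)
    (h : ∀ z ∈ (minpoly ℚ θ).aroots ℂ, ‖z‖ ≤ 1) : ∃ m : ℕ, 0 < m ∧ θ ^ m = 1 := by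
  have hθQ : IsIntegral ℚ θ := hθ.tower_top
  have : FiniteDimensional ℚ ℚ⟮θ⟯ := adjoin.finiteDimensional hθQ
  have : NumberField ℚ⟮θ⟯ := { to_charZero := inferInstance, to_finiteDimensional := this }
  have hconj : ∀ φ : ℚ⟮θ⟯ →+* ℂ, ‖φ (AdjoinSimple.gen ℚ θ)‖ ≤ 1 := fun φ => by
    refine h _ (Polynomial.mem_aroots.2 ⟨minpoly.ne_zero hθQ, ?_⟩)
    have hg : (minpoly ℚ θ).eval₂ (algebraMap ℚ ℚ⟮θ⟯) (AdjoinSimple.gen ℚ θ) = 0 := by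
      refine (algebraMap ℚ⟮θ⟯ ℂ).injective ?_
      rw [Polynomial.hom_eval₂, map_zero, AdjoinSimple.algebraMap_gen, ← minpoly.aeval ℚ θ,
        Polynomial.aeval_def]
      congr 1
    have := congrArg φ hg
    rw [Polynomial.hom_eval₂, map_zero] at this
    rw [Polynomial.aeval_def, ← this]
    congr 1
    exact Subsingleton.elim _ _
  obtain ⟨m, hm, hgm⟩ := NumberField.Embeddings.pow_eq_one_of_norm_le_one ℚ⟮θ⟯ ℂ
    (fun h0 => hθ0 (by rw [← AdjoinSimple.coe_gen ℚ θ, h0]; rfl))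
    (IntermediateField.coe_isIntegral_iff.mp (by rwa [AdjoinSimple.coe_gen])) hconj
  exact ⟨m, hm, by rw [← AdjoinSimple.coe_gen ℚ θ, ← IntermediateField.coe_pow, hgm]; rfl⟩

theorem polyEntropy_pos (hA : IsUnit A.det) (herg : Ergodic (toralMap A) (torusMeasure d))
    {P : Polynomial ℚ} (hP : P.Monic) (hirr : Irreducible P)
    (hdvd : P ∣ A.charpoly.map (Int.castRingHom ℚ)) : 0 < polyEntropy P := by
  obtain ⟨θ, hθ⟩ := IsAlgClosed.exists_aeval_eq_zero ℂ P hirr.degree_pos.ne'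
  have hmin : P = minpoly ℚ θ := minpoly.eq_of_irreducible_of_monic hirr hθ hP
  have hchar : Polynomial.aeval θ A.charpoly = 0 := by
    obtain ⟨Q, hQ⟩ := hdvd
    have := congrArg (Polynomial.aeval θ) hQ
    rwa [map_mul, hθ, zero_mul, show Int.castRingHom ℚ = algebraMap ℤ ℚ from rfl,
      Polynomial.aeval_map_algebraMap] at this
  have hθ0 : θ ≠ 0 := by
    rintro rfl
    rw [Polynomial.aeval_def, Polynomial.eval₂_at_zero] at hchar
    have h0 : A.charpoly.coeff 0 = 0 :=
      (algebraMap ℤ ℂ).injective_int (hchar.trans (map_zero _).symm)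
    rw [Matrix.det_eq_sign_charpoly_coeff, h0, mul_zero] at hA
    exact not_isUnit_zero hA
  refine lt_of_le_of_ne (polyEntropy_nonneg P) fun h0 => ?_
  obtain ⟨m, hm, hθm⟩ := exists_pow_eq_one_of_conjugates_le_one hθ0 (isIntegral_eigenvalue hchar)
    (fun z hz => by
      rw [← hmin] at hz
      have : Real.posLog ‖z‖ = 0 := le_antisymm
        (h0 ▸ Multiset.single_le_sum (fun x hx => by
          obtain ⟨z, -, rfl⟩ := Multiset.mem_map.1 hx
          exact Real.posLog_nonneg) _ (Multiset.mem_map_of_mem _ hz)) Real.posLog_nonneg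
      rwa [Real.posLog_eq_zero_iff, abs_norm] at this)
  exact pow_ne_one_of_ergodic herg hchar hm hθm

theorem minAvgEntropy_pos (hd : 0 < d) (hA : IsUnit A.det)
    (herg : Ergodic (toralMap A) (torusMeasure d)) : 0 < minAvgEntropy A := by
  classical
  set Q := A.charpoly.map (Int.castRingHom ℚ) with hQ
  have hQm : Q.Monic := A.charpoly_monic.map _
  set s : Set ℝ := {x : ℝ | ∃ P : Polynomial ℚ, P.Monic ∧ Irreducible P ∧ P ∣ Q ∧
    x = polyEntropy P / (P.natDegree : ℝ)} with hs
  have hfin : s.Finite := by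
    refine ((UniqueFactorizationMonoid.normalizedFactors Q).toFinset.finite_toSet.image
      fun P => polyEntropy P / (P.natDegree : ℝ)).subset ?_
    rintro x ⟨P, hP, hirr, hdvd, rfl⟩
    exact ⟨P, Finset.mem_coe.2 (Multiset.mem_toFinset.2
      ((Polynomial.mem_normalizedFactors_iff hQm.ne_zero).2 ⟨hirr, hP, hdvd⟩)), rfl⟩
  -- This uses `0 < d`: in dimension `0` there are no irreducible factors, and the infimum takes its
  -- default value `0`.
  have hne : s.Nonempty := by
    have hdeg : Q.natDegree = d := by
      rw [hQ, A.charpoly_monic.natDegree_map, Matrix.charpoly_natDegree_eq_dim, Fintype.card_fin]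
    obtain ⟨P, hP, hirr, hdvd⟩ := Polynomial.exists_monic_irreducible_factor Q fun hu => by
      rw [Polynomial.natDegree_eq_zero_of_isUnit hu] at hdeg
      omega
    exact ⟨_, P, hP, hirr, hdvd, rfl⟩
  obtain ⟨P, hP, hirr, hdvd, h⟩ := hne.csInf_mem hfin
  change 0 < sInf s
  rw [h]
  exact div_pos (polyEntropy_pos hA herg hP hirr hdvd) (by exact_mod_cast hirr.natDegree_pos)

end Ergodicity

/-! ### Energy of orbits and decay of correlations. -/

section Decay

variable {d : ℕ} {A : Matrix (Fin d) (Fin d) ℤ}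

/-- The action of a unimodular integer matrix on frequencies. -/
noncomputable def mulVecEquiv (hA : IsUnit A.det) : (Fin d → ℤ) ≃ (Fin d → ℤ) where
  toFun := A.mulVec
  invFun := A⁻¹.mulVec
  left_inv k := by simp [Matrix.mulVec_mulVec, Matrix.nonsing_inv_mul A hA]
  right_inv k := by simp [Matrix.mulVec_mulVec, Matrix.mul_nonsing_inv A hA]

theorem isUnit_det_pow (hA : IsUnit A.det) (n : ℕ) : IsUnit (A ^ n).det := by
  rw [Matrix.det_pow]; exact hA.pow n

theorem sqNorm_nonneg (k : Fin d → ℤ) : 0 ≤ sqNorm k := Finset.sum_nonneg fun _ _ => sq_nonneg _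

theorem one_le_sqNorm {k : Fin d → ℤ} (hk : k ≠ 0) : 1 ≤ sqNorm k := by
  obtain ⟨i, hi⟩ := Function.ne_iff.1 hk
  refine le_trans ?_ (Finset.single_le_sum (f := fun i => (k i : ℝ) ^ 2) (fun _ _ => sq_nonneg _)
    (Finset.mem_univ i))
  have : (1 : ℤ) ≤ k i ^ 2 := sq_pos_of_ne_zero hi
  exact_mod_cast this

theorem exp_pow_le_sqNorm_add (hdiag : IsDiagonalizable A) :
    ∃ C : ℝ, 0 < C ∧ ∀ k : Fin d → ℤ, k ≠ 0 → ∀ n : ℕ,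
      Real.exp (2 * minAvgEntropy A) ^ n ≤ C * (sqNorm k + sqNorm ((A ^ n).mulVec k)) := by
  obtain ⟨C, hC, h⟩ := exp_minAvgEntropy_le hdiag
  refine ⟨C ^ 2, by positivity, fun k hk n => ?_⟩
  have h1 := pow_le_pow_left₀ (Real.exp_pos _).le (h k hk n) 2
  calc Real.exp (2 * minAvgEntropy A) ^ n = Real.exp (n * minAvgEntropy A) ^ 2 := by
        rw [← Real.exp_nat_mul, ← Real.exp_nat_mul]; congr 1; push_cast; ring
    _ ≤ (C * max ‖k‖ ‖(A ^ n).mulVec k‖) ^ 2 := h1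
    _ = C ^ 2 * (max ‖k‖ ‖(A ^ n).mulVec k‖) ^ 2 := mul_pow _ _ _
    _ ≤ _ := by
        gcongr
        have h2 := norm_sq_le_sqNorm k
        have h3 := norm_sq_le_sqNorm ((A ^ n).mulVec k)
        have h4 := sqNorm_nonneg k
        have h5 := sqNorm_nonneg ((A ^ n).mulVec k)
        rcases max_choice ‖k‖ ‖(A ^ n).mulVec k‖ with e | e <;> rw [e] <;> linarith

theorem pow_le_orbit_energy (hA : IsUnit A.det) (hdiag : IsDiagonalizable A) {lam : ℝ}
    (hlam : 0 < lam) (hlt : lam < Real.exp (2 * minAvgEntropy A)) :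
    ∃ N : ℕ, 1 ≤ N ∧ (lam ≤ 1 → N = 1) ∧ ∀ n : ℕ, N ≤ n → ∀ k : Fin d → ℤ, k ≠ 0 →
      lam ^ n ≤ ∑ j ∈ Finset.range n, sqNorm ((A ^ (j + 1)).mulVec k) ∧
      lam ^ n ≤ sqNorm k + sqNorm ((A ^ n).mulVec k) := by
  have hne : ∀ n (k : Fin d → ℤ), k ≠ 0 → (A ^ n).mulVec k ≠ 0 := fun n k hk h0 => hk <|
    (mulVecEquiv (isUnit_det_pow hA n)).injective (h0.trans (Matrix.mulVec_zero (A ^ n)).symm : (A ^ n).mulVec k = (A ^ n).mulVec 0)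
  -- For `lam ≤ 1` it is enough that nonzero integer vectors have squared norm at least 1.
  rcases le_or_gt lam 1 with hl | hl
  · refine ⟨1, le_rfl, fun _ => rfl, fun n hn k hk => ?_⟩
    have hp : lam ^ n ≤ 1 := pow_le_one₀ hlam.le hl
    have h1 := one_le_sqNorm hk
    have h2 := sqNorm_nonneg ((A ^ n).mulVec k)
    refine ⟨hp.trans ?_, by linarith⟩
    have h3 := Finset.single_le_sum (f := fun j => sqNorm ((A ^ (j + 1)).mulVec k))
      (fun _ _ => sqNorm_nonneg _) (Finset.mem_range.2 (by omega : 0 < n))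
    rw [zero_add] at h3
    exact (one_le_sqNorm (hne 1 k hk)).trans h3
  · obtain ⟨C, hC, h⟩ := exp_pow_le_sqNorm_add hdiag
    set q := Real.exp (2 * minAvgEntropy A) with hq
    have hq1 : 1 < q := hl.trans hlt
    have hlim : Tendsto (fun n : ℕ => (lam / q) ^ n) atTop (𝓝 0) :=
      tendsto_pow_atTop_nhds_zero_of_lt_one (by positivity) ((div_lt_one (by positivity)).2 hlt)
    obtain ⟨N, hN⟩ := eventually_atTop.1
      -- The strict inequality `lam < q` absorbs the Diophantine constant `C` and one further factor
      -- `q`, which is lost below.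
      (hlim.eventually (ge_mem_nhds (by positivity : 0 < 1 / (C * q))))
    refine ⟨max N 2, by omega, fun h => absurd h (not_le.2 hl), fun n hn k hk => ?_⟩
    have hn2 : 2 ≤ n := le_trans (le_max_right _ _) hn
    have hkey : C * q * lam ^ n ≤ q ^ n := by
      have := hN n (le_trans (le_max_left _ _) hn)
      rw [div_pow, div_le_div_iff₀ (by positivity) (by positivity)] at this
      linarith
    constructor
    -- The noisy energy starts at `A k`, not at `k`, so the estimate is applied to `A k` over time
    -- `n - 1`, costing a factor `q`. Having `n ≥ 2` makes the first and last terms of the sum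
    -- distinct.
    · obtain ⟨m, rfl⟩ : ∃ m, n = m + 1 + 1 := ⟨n - 2, by omega⟩
      have h1 := h (A.mulVec k) (by simpa using hne 1 k hk) (m + 1)
      rw [Matrix.mulVec_mulVec, ← pow_succ] at h1
      have h2 : sqNorm (A.mulVec k) + sqNorm ((A ^ (m + 1 + 1)).mulVec k) ≤
          ∑ j ∈ Finset.range (m + 1 + 1), sqNorm ((A ^ (j + 1)).mulVec k) := by
        rw [Finset.sum_range_succ, Finset.sum_range_succ', zero_add, pow_one]
        have := Finset.sum_nonneg fun j (_ : j ∈ Finset.range m) =>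
          sqNorm_nonneg ((A ^ (j + 1 + 1)).mulVec k)
        linarith
      refine le_trans ?_ h2
      rw [pow_succ q, mul_right_comm] at hkey
      have h3 := le_of_mul_le_mul_right hkey (by positivity)
      exact le_of_mul_le_mul_left (h3.trans h1) hC
    · refine le_of_mul_le_mul_left (le_trans ?_ (h k hk n)) hC
      refine le_trans ?_ hkey
      rw [mul_right_comm]
      exact le_mul_of_one_le_right (by positivity) hq1.le

theorem koopman_iterate_spec
    (hF : MeasurePreserving (toralMap A) (torusMeasure d) (torusMeasure d))
    {h : UnitAddTorus (Fin d) → ℂ} (hh : MemLp h 2 (torusMeasure d)) (n : ℕ) :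
    MemLp ((koopman (toralMap A))^[n] h) 2 (torusMeasure d) ∧ ∀ k,
      torusCoeff ((koopman (toralMap A))^[n] h) ((A ^ n).mulVec k) = torusCoeff h k := by
  induction n with
  | zero => exact ⟨hh, fun k => by simp⟩
  | succ n ih =>
    rw [Function.iterate_succ_apply']
    refine ⟨ih.1.comp_measurePreserving hF, fun k => ?_⟩
    rw [pow_succ', ← Matrix.mulVec_mulVec, koopman, torusCoeff_comp hF ih.1, ih.2]

theorem noisyPropagator_iterate_spec
    (hF : MeasurePreserving (toralMap A) (torusMeasure d) (torusMeasure d)) {ε : ℝ} (hε : 0 < ε)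
    {h : UnitAddTorus (Fin d) → ℂ} (hh : MemLp h 2 (torusMeasure d)) (n : ℕ) :
    MemLp ((noisyPropagator (toralMap A) ε)^[n] h) 2 (torusMeasure d) ∧ ∀ k,
      torusCoeff ((noisyPropagator (toralMap A) ε)^[n] h) ((A ^ n).mulVec k) =
        Real.exp (-(ε ^ 2 * ∑ j ∈ Finset.range n, sqNorm ((A ^ (j + 1)).mulVec k))) *
          torusCoeff h k := by
  induction n with
  | zero => exact ⟨hh, fun k => by simp⟩
  | succ n ih =>
    rw [Function.iterate_succ_apply']
    have hK := ih.1.comp_measurePreserving hF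
    refine ⟨(noiseOp_spec hε hK).1, fun k => ?_⟩
    have e : torusCoeff ((noisyPropagator (toralMap A) ε)^[n] h ∘ toralMap A)
        ((A ^ (n + 1)).mulVec k) =
        torusCoeff ((noisyPropagator (toralMap A) ε)^[n] h) ((A ^ n).mulVec k) := by
      rw [pow_succ', ← Matrix.mulVec_mulVec, torusCoeff_comp hF ih.1]
    rw [noisyPropagator, koopman, (noiseOp_spec hε hK).2, e, ih.2, Finset.sum_range_succ, mul_add,
      neg_add, Real.exp_add]
    push_cast
    ring

theorem norm_noisyCorrelation_le (hA : IsUnit A.det)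
    (hF : MeasurePreserving (toralMap A) (torusMeasure d) (torusMeasure d)) {ε : ℝ} (hε : 0 < ε)
    {f h : UnitAddTorus (Fin d) → ℂ} (hf : IsL20 f) (hh : IsL20 h) {n : ℕ} {b : ℝ}
    (hb : ∀ k : Fin d → ℤ, k ≠ 0 →
      b ≤ ∑ j ∈ Finset.range n, sqNorm ((A ^ (j + 1)).mulVec k)) :
    ‖noisyCorrelation (toralMap A) ε f h n‖ ≤
      l2norm f * l2norm h * Real.exp (-(ε ^ 2 * b)) := by
  obtain ⟨hT, hTk⟩ := noisyPropagator_iterate_spec hF hε hh.1 n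
  have hle : l2norm ((noisyPropagator (toralMap A) ε)^[n] h) ≤
      Real.exp (-(ε ^ 2 * b)) * l2norm h := by
    refine l2norm_le_of_torusCoeff hh.1 hT (Real.exp_pos _).le
      (mulVecEquiv (isUnit_det_pow hA n)) fun k => ?_
    change ‖torusCoeff _ ((A ^ n).mulVec k)‖ ≤ _
    rw [hTk, norm_mul, Complex.norm_real, Real.norm_eq_abs, Real.abs_exp]
    -- The zero frequency is not damped; its coefficient vanishes because `h` has zero mean.
    rcases eq_or_ne k 0 with rfl | hk
    · rw [torusCoeff_zero, hh.2, norm_zero, mul_zero, mul_zero]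
    · have := hb k hk
      gcongr
  calc ‖noisyCorrelation (toralMap A) ε f h n‖
      ≤ l2norm f * l2norm ((noisyPropagator (toralMap A) ε)^[n] h) := norm_integral_mul_le hf.1 hT
    _ ≤ l2norm f * (Real.exp (-(ε ^ 2 * b)) * l2norm h) :=
        mul_le_mul_of_nonneg_left hle ENNReal.toReal_nonneg
    _ = _ := by ring

theorem norm_correlation_le (hA : IsUnit A.det)
    (hF : MeasurePreserving (toralMap A) (torusMeasure d) (torusMeasure d)) {ε : ℝ} (hε : 0 < ε)
    {f h f₀ h₀ : UnitAddTorus (Fin d) → ℂ} (hf : IsNoisePreimage ε f₀ f)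
    (hh : IsNoisePreimage ε h₀ h) {n : ℕ} {b : ℝ}
    (hb : ∀ k : Fin d → ℤ, k ≠ 0 → b ≤ sqNorm k + sqNorm ((A ^ n).mulVec k)) :
    ‖correlation (toralMap A) f h n‖ ≤ l2norm f₀ * l2norm h₀ * Real.exp (-(ε ^ 2 * b)) := by
  have hG := noiseOp_spec hε hh.1.1
  obtain ⟨hT, hTk⟩ := koopman_iterate_spec hF (hG.1.ae_eq hh.2.symm) n
  obtain ⟨hGT, hGTk⟩ := noiseOp_spec hε hT
  have hle : l2norm (noiseOp ε ((koopman (toralMap A))^[n] h)) ≤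
      Real.exp (-(ε ^ 2 * b)) * l2norm h₀ := by
    refine l2norm_le_of_torusCoeff hh.1.1 hGT (Real.exp_pos _).le
      (mulVecEquiv (isUnit_det_pow hA n)) fun k => ?_
    change ‖torusCoeff _ ((A ^ n).mulVec k)‖ ≤ _
    rw [hGTk, hTk, torusCoeff_congr hh.2, hG.2, ← mul_assoc, ← Complex.ofReal_mul, ← Real.exp_add,
      norm_mul, Complex.norm_real, Real.norm_eq_abs, Real.abs_exp]
    rcases eq_or_ne k 0 with rfl | hk
    · rw [torusCoeff_zero, hh.1.2, norm_zero, mul_zero, mul_zero]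
    · refine mul_le_mul_of_nonneg_right (Real.exp_le_exp.2 ?_) (norm_nonneg _)
      have := mul_le_mul_of_nonneg_left (hb k hk) (sq_nonneg ε)
      linarith
  -- The noise contained in `f` is moved onto the evolved `h`, so that modes are damped at both ends
  -- of the orbit.
  have e : correlation (toralMap A) f h n =
      ∫ x, f₀ x * noiseOp ε ((koopman (toralMap A))^[n] h) x ∂(torusMeasure d) := by
    rw [← integral_noiseOp_mul hε hf.1.1 hT]
    exact integral_congr_ae (hf.2.mono fun x hx => by simp only [hx])
  calc ‖correlation (toralMap A) f h n‖
      ≤ l2norm f₀ * l2norm (noiseOp ε ((koopman (toralMap A))^[n] h)) := by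
        rw [e]; exact norm_integral_mul_le hf.1.1 hGT
    _ ≤ l2norm f₀ * (Real.exp (-(ε ^ 2 * b)) * l2norm h₀) :=
        mul_le_mul_of_nonneg_left hle ENNReal.toReal_nonneg
    _ = _ := by ring

theorem tendsto_pow_mul_exp_neg_pow {r c lam : ℝ} (hr : 0 < r) (hc : 0 < c) (hlam : 1 < lam) :
    Tendsto (fun n : ℕ => r ^ n * Real.exp (-(c * lam ^ n))) atTop (𝓝 0) := by
  -- With `r < lam ^ m`, the quantity is dominated by `x ^ m * exp (-c x)` at `x = lam ^ n`.
  obtain ⟨m, hm⟩ := pow_unbounded_of_one_lt r hlam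
  have h := (tendsto_rpow_mul_exp_neg_mul_atTop_nhds_zero (m : ℝ) c hc).comp
    (tendsto_pow_atTop_atTop_of_one_lt hlam)
  refine squeeze_zero (fun n => by positivity) (fun n => ?_) h
  simp only [Function.comp_apply, Real.rpow_natCast, neg_mul]
  rw [← pow_mul, mul_comm n m, pow_mul]
  gcongr

theorem tendsto_pow_mul_of_superexponential {C : ℕ → ℝ} {M c r lam : ℝ} {N : ℕ} (hr : 0 < r)
    (hc : 0 < c) (hlam : 1 < lam) (hC0 : ∀ n, 0 ≤ C n)
    (hC : ∀ n, N ≤ n → C n ≤ M * Real.exp (-(c * lam ^ n))) :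
    Tendsto (fun n : ℕ => r ^ n * C n) atTop (𝓝 0) := by
  have h := (tendsto_pow_mul_exp_neg_pow hr hc hlam).const_mul M
  rw [mul_zero] at h
  refine tendsto_of_tendsto_of_tendsto_of_le_of_le' tendsto_const_nhds h
    (.of_forall fun n => mul_nonneg (by positivity) (hC0 n)) ?_
  filter_upwards [eventually_ge_atTop N] with n hn
  calc r ^ n * C n ≤ r ^ n * (M * Real.exp (-(c * lam ^ n))) := by gcongr; exact hC n hn
    _ = _ := by ring

end Decay

end ToralNoise

theorem mainTheorem11 (d : ℕ) (hd : 0 < d) (A : Matrix (Fin d) (Fin d) ℤ)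
    (hA : IsUnit A.det) (hdiag : ToralNoise.IsDiagonalizable A)
    (herg : Ergodic (ToralNoise.toralMap A) (ToralNoise.torusMeasure d)) :
    (∀ lam : ℝ, 0 < lam → lam < Real.exp (2 * ToralNoise.minAvgEntropy A) →
      ∃ N : ℕ, 1 ≤ N ∧ (lam ≤ 1 → N = 1) ∧ ∀ n : ℕ, N ≤ n → ∀ ε : ℝ, 0 < ε →
        (∀ f h : UnitAddTorus (Fin d) → ℂ, ToralNoise.IsL20 f → ToralNoise.IsL20 h →
          ‖ToralNoise.noisyCorrelation (ToralNoise.toralMap A) ε f h n‖ ≤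
            ToralNoise.l2norm f * ToralNoise.l2norm h * Real.exp (-(ε ^ 2 * lam ^ n))) ∧
        (∀ f h f₀ h₀ : UnitAddTorus (Fin d) → ℂ,
          ToralNoise.IsNoisePreimage ε f₀ f → ToralNoise.IsNoisePreimage ε h₀ h →
          ‖ToralNoise.correlation (ToralNoise.toralMap A) f h n‖ ≤
            ToralNoise.l2norm f₀ * ToralNoise.l2norm h₀ * Real.exp (-(ε ^ 2 * lam ^ n)))) ∧
    (∀ ε : ℝ, 0 < ε → ∀ r : ℝ, 0 < r →
      (∀ f h : UnitAddTorus (Fin d) → ℂ, ToralNoise.IsL20 f → ToralNoise.IsL20 h →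
        Tendsto (fun n : ℕ =>
          r ^ n * ‖ToralNoise.noisyCorrelation (ToralNoise.toralMap A) ε f h n‖) atTop (𝓝 0)) ∧
      (∀ f h f₀ h₀ : UnitAddTorus (Fin d) → ℂ,
        ToralNoise.IsNoisePreimage ε f₀ f → ToralNoise.IsNoisePreimage ε h₀ h →
        Tendsto (fun n : ℕ =>
          r ^ n * ‖ToralNoise.correlation (ToralNoise.toralMap A) f h n‖) atTop (𝓝 0))) := by
  have hF := herg.toMeasurePreserving
  refine ⟨fun lam hlam hlt => ?_, fun ε hε r hr => ?_⟩
  · obtain ⟨N, hN1, hN, h⟩ := ToralNoise.pow_le_orbit_energy hA hdiag hlam hlt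
    exact ⟨N, hN1, hN, fun n hn ε hε =>
      ⟨fun f g hf hg =>
        ToralNoise.norm_noisyCorrelation_le hA hF hε hf hg fun k hk => (h n hn k hk).1,
      fun f g f₀ g₀ hf hg =>
        ToralNoise.norm_correlation_le hA hF hε hf hg fun k hk => (h n hn k hk).2⟩⟩
  · have hpos := ToralNoise.minAvgEntropy_pos hd hA herg
    -- Any rate strictly between `1` and `exp (2 ĥ)` would do; `exp ĥ` is one because `ĥ > 0`.
    have hlam : 1 < Real.exp (ToralNoise.minAvgEntropy A) := Real.one_lt_exp_iff.2 hpos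
    obtain ⟨N, -, -, h⟩ := ToralNoise.pow_le_orbit_energy hA hdiag (zero_lt_one.trans hlam)
      (Real.exp_lt_exp.2 (by linarith))
    exact ⟨fun f g hf hg =>
      ToralNoise.tendsto_pow_mul_of_superexponential (N := N) hr (pow_pos hε 2) hlam
        (fun _ => norm_nonneg _) fun n hn =>
          ToralNoise.norm_noisyCorrelation_le hA hF hε hf hg fun k hk => (h n hn k hk).1,
      fun f g f₀ g₀ hf hg =>
      ToralNoise.tendsto_pow_mul_of_superexponential (N := N) hr (pow_pos hε 2) hlam
        (fun _ => norm_nonneg _) fun n hn =>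
          ToralNoise.norm_correlation_le hA hF hε hf hg fun k hk => (h n hn k hk).2⟩
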